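/- Let $(M,g)$ be a smooth Riemannian manifold of dimension $n$ (without boundary) with Levi-Civita connection $\nabla$, and let $\alpha$ be a smooth symmetric $2$-tensor field on $TM$. Let $\alpha^{\sharp}$ be the endomorphism field defined by $g(\alpha^{\sharp}(X),Y)=\alpha(X,Y)$, and for $1\le m\le n$ let $G_m(x)$ denote the sum of the $m$ smallest eigenvalues (counted with multiplicity) of $\alpha^{\sharp}$ at $x$. Let $x_0\in M$ and let $\xi$ be a (local) lower support for $G_m$ at $x_0$: a smooth function on an open neighbourhood of $x_0$ with $\xi\le G_m$ there and $\xi(x_0)=G_m(x_0)$. Let $(e_k)_{1\le k\le n}$ be any orthonormal basis of $T_{x_0}M$ with $\alpha^{\sharp}e_k=\lambda_k e_k$ and \[\lambda_1\le\cdots\le\lambda_m=\cdots=\lambda_{D_m}<\lambda_{D_m+1}\le\cdots\le\lambda_n,\] which defines $D_m\in\{m,\dots,n\}$, and put $V_m=\operatorname{span}\{e_1,\dots,e_m\}$. Write $\alpha_{kl;i}=(\nabla_{e_i}\alpha)(e_k,e_l)$, $\alpha_{kl;ii}=(\nabla^2_{e_i,e_i}\alpha)(e_k,e_l)$, $\xi_{;i}=d\xi(e_i)$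 and $\xi_{;ii}=(\nabla^2\xi)(e_i,e_i)$. Then at $x_0$, for every $1\le i\le n$: \begin{enumerate} \item $\displaystyle \xi_{;i}=\operatorname{tr}_{V_m}\alpha_{;i}=\sum_{k=1}^m\alpha_{kk;i}$, where $\operatorname{tr}_{V_m}\alpha_{;i}$ is the trace with respect to $g$ of the restriction of $\nabla_{e_i}\alpha$ to $V_m$; \item $\displaystyle \xi_{;ii}\le\sum_{k=1}^m\alpha_{kk;ii}-2\sum_{k=1}^m\sum_{r>D_m}\frac{(\alpha_{kr;i})^2}{\lambda_r-\lambda_k}$. \end{enumerate} -/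

import Mathlib

open scoped Manifold ContDiff

noncomputable section

namespace Subtrace

/-! ### Linear algebra of a symmetric bilinear form on a Euclidean vector space -/

section LinearAlgebra

variable {V : Type*} [NormedAddCommGroup V] [InnerProductSpace ℝ V] [FiniteDimensional ℝ V]

/-- The metric raised endomorphism `B♯` of a bilinear form `B`, determined by
`⟪B♯ v, w⟫ = B v w` (see `inner_sharp`). -/
def sharp (B : V →L[ℝ] V →L[ℝ] ℝ) : V →ₗ[ℝ] V :=
  haveI : CompleteSpace V := FiniteDimensional.complete ℝ V
  { toFun := fun v => (InnerProductSpace.toDual ℝ V).symm (B v)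
    map_add' := fun v w => by simp
    map_smul' := fun c v => by simp }

theorem inner_sharp (B : V →L[ℝ] V →L[ℝ] ℝ) (v w : V) : inner ℝ (sharp B v) w = B v w := by
  have : CompleteSpace V := FiniteDimensional.complete ℝ V
  exact InnerProductSpace.toDual_symm_apply (𝕜 := ℝ) (E := V)

theorem sharp_isSymmetric {B : V →L[ℝ] V →L[ℝ] ℝ} (hB : ∀ v w, B v w = B w v) :
    (sharp B).IsSymmetric := fun v w => by
  rw [inner_sharp, real_inner_comm, inner_sharp, hB]

/-- The eigenvalues of `B♯`, repeated according to multiplicity, in increasing order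
`λ₁ ≤ ⋯ ≤ λₙ` (indexed from `0`; Mathlib lists them in decreasing order). -/
def eigenvalue (B : V →L[ℝ] V →L[ℝ] ℝ) (hB : ∀ v w, B v w = B w v)
    (k : Fin (Module.finrank ℝ V)) : ℝ :=
  (sharp_isSymmetric hB).eigenvalues rfl k.rev

theorem eigenvalue_monotone (B : V →L[ℝ] V →L[ℝ] ℝ) (hB : ∀ v w, B v w = B w v) :
    Monotone (eigenvalue B hB) := fun _ _ h =>
  (sharp_isSymmetric hB).eigenvalues_antitone rfl (Fin.rev_le_rev.mpr h)

/-- The subtrace `G_m = λ₁ + ⋯ + λ_m`. -/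
def subtrace (m : ℕ) (B : V →L[ℝ] V →L[ℝ] ℝ) (hB : ∀ v w, B v w = B w v) : ℝ :=
  ∑ k with k.val < m, eigenvalue B hB k

/-- The pullback `(v, w) ↦ B (L v, L w)` of a bilinear form. -/
def pullback {V W : Type*} [AddCommGroup V] [Module ℝ V] [TopologicalSpace V]
    [AddCommGroup W] [Module ℝ W] [TopologicalSpace W]
    (B : V →L[ℝ] V →L[ℝ] ℝ) (L : W →L[ℝ] V) : W →L[ℝ] W →L[ℝ] ℝ :=
  (ContinuousLinearMap.precomp ℝ L) ∘L (B ∘L L)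

/-- The trace, with respect to the inner product, of the restriction of `B` to `W`. -/
def traceOn (W : Submodule ℝ V) (B : V →L[ℝ] V →L[ℝ] ℝ) : ℝ :=
  LinearMap.trace ℝ W (sharp (pullback B W.subtypeL))

end LinearAlgebra

/-! ### Covariant derivatives in coordinates

`E` is the coordinate space, `g` the coordinate expression of a Riemannian metric and `a` that of a
`2`-tensor. -/

section Coordinates

variable {E : Type*} [NormedAddCommGroup E] [NormedSpace ℝ E]

/-- The Christoffel symbol of the first kind at `y`:
`(v, w) ↦ (1/2) (D_u g (v, w) + D_v g (u, w) - D_w g (u, v))`. -/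
def christoffelFirst (g : E → E →L[ℝ] E →L[ℝ] ℝ) (y u : E) : E →L[ℝ] E →L[ℝ] ℝ :=
  let dg : E →L[ℝ] E →L[ℝ] E →L[ℝ] ℝ := fderiv ℝ g y
  (1 / 2 : ℝ) • (dg u + dg.flip u - (dg.flip u).flip)

theorem christoffelFirst_apply (g : E → E →L[ℝ] E →L[ℝ] ℝ) (y u v w : E) :
    christoffelFirst g y u v w =
      1 / 2 * (fderiv ℝ g y u v w + fderiv ℝ g y v u w - fderiv ℝ g y w u v) := by
  simp [christoffelFirst]

/-- The Christoffel symbol `v ↦ Γ_y(u, v)` of the Levi-Civita connection, obtained by raising the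
index of `christoffelFirst`: `g_y (Γ_y(u, v), w) = christoffelFirst g y u v w`. -/
def christoffel (g : E → E →L[ℝ] E →L[ℝ] ℝ) (y u : E) : E →L[ℝ] E :=
  (g y).inverse ∘L christoffelFirst g y u

/-- `∇²f (u, v) = D²f (u, v) - Df (Γ(u, v))`, the second covariant derivative of a function. -/
def coordHessian (g : E → E →L[ℝ] E →L[ℝ] ℝ) (f : E → ℝ) (y u v : E) : ℝ :=
  fderiv ℝ (fderiv ℝ f) y u v - fderiv ℝ f y (christoffel g y u v)

/-- The covariant derivative `∇_u a` at `y`: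
`(∇_u a) (v, w) = D_u a (v, w) - a (Γ(u, v), w) - a (v, Γ(u, w))`. -/
def coordCov (g a : E → E →L[ℝ] E →L[ℝ] ℝ) (y u : E) : E →L[ℝ] E →L[ℝ] ℝ :=
  fderiv ℝ a y u - a y ∘L christoffel g y u -
    (ContinuousLinearMap.precomp ℝ (christoffel g y u)) ∘L a y

theorem coordCov_apply (g a : E → E →L[ℝ] E →L[ℝ] ℝ) (y u v w : E) :
    coordCov g a y u v w =
      fderiv ℝ a y u v w - a y (christoffel g y u v) w - a y v (christoffel g y u w) := rfl

/-- The second covariant derivative `(∇²_{t, u} a) (v, w)` at `y`, that is, the covariant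
derivative in direction `t` of the `3`-tensor `(u, v, w) ↦ (∇_u a) (v, w)`. -/
def coordCov₂ (g a : E → E →L[ℝ] E →L[ℝ] ℝ) (y t u v w : E) : ℝ :=
  fderiv ℝ (fun z => coordCov g a z u v w) y t
    - coordCov g a y (christoffel g y t u) v w
    - coordCov g a y u (christoffel g y t v) w
    - coordCov g a y u v (christoffel g y t w)

end Coordinates

/-! ### Riemannian manifolds -/

section Manifold

open Bundle

variable {n : ℕ} {M : Type*} [TopologicalSpace M] [ChartedSpace (EuclideanSpace ℝ (Fin n)) M]

instance (x : M) : FiniteDimensional ℝ (TangentSpace (𝓡 n) x) :=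
  inferInstanceAs (FiniteDimensional ℝ (EuclideanSpace ℝ (Fin n)))

/-- The coordinate expression of a `2`-tensor field `α` in the chart around `p`, that is, the
pullback of `α` under the inverse of the chart. -/
def coordTensor (p : M)
    (α : Π x : M, TangentSpace (𝓡 n) x →L[ℝ] TangentSpace (𝓡 n) x →L[ℝ] ℝ)
    (y : EuclideanSpace ℝ (Fin n)) :
    EuclideanSpace ℝ (Fin n) →L[ℝ] EuclideanSpace ℝ (Fin n) →L[ℝ] ℝ :=
  pullback (α ((extChartAt (𝓡 n) p).symm y))
    (mfderiv 𝓘(ℝ, EuclideanSpace ℝ (Fin n)) (𝓡 n) (extChartAt (𝓡 n) p).symm y)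

/-- The differential at `p` of the chart around `p`: it gives the coordinate components of a
tangent vector at `p`. -/
def coordVec (p : M) : TangentSpace (𝓡 n) p →L[ℝ] EuclideanSpace ℝ (Fin n) :=
  mfderiv (𝓡 n) 𝓘(ℝ, EuclideanSpace ℝ (Fin n)) (extChartAt (𝓡 n) p) p

variable [RiemannianBundle (fun x : M => TangentSpace (𝓡 n) x)]

/-- The Riemannian metric as a `2`-tensor field. -/
def metric (x : M) : TangentSpace (𝓡 n) x →L[ℝ] TangentSpace (𝓡 n) x →L[ℝ] ℝ :=
  innerSL ℝ

/-- The second covariant derivative `∇²f (u, v)` at `p` of a function. -/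
def hessian (f : M → ℝ) (p : M) (u v : TangentSpace (𝓡 n) p) : ℝ :=
  coordHessian (coordTensor p metric) (f ∘ (extChartAt (𝓡 n) p).symm) (extChartAt (𝓡 n) p p)
    (coordVec p u) (coordVec p v)

/-- The covariant derivative `(v, w) ↦ (∇_u α) (v, w)` at `p` for the Levi-Civita connection. -/
def cov (α : Π x : M, TangentSpace (𝓡 n) x →L[ℝ] TangentSpace (𝓡 n) x →L[ℝ] ℝ) (p : M)
    (u : TangentSpace (𝓡 n) p) : TangentSpace (𝓡 n) p →L[ℝ] TangentSpace (𝓡 n) p →L[ℝ] ℝ :=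
  pullback (coordCov (coordTensor p metric) (coordTensor p α) (extChartAt (𝓡 n) p p)
    (coordVec p u)) (coordVec p)

/-- The second covariant derivative `(∇²_{t, u} α) (v, w)` at `p` for the Levi-Civita connection. -/
def cov₂ (α : Π x : M, TangentSpace (𝓡 n) x →L[ℝ] TangentSpace (𝓡 n) x →L[ℝ] ℝ) (p : M)
    (t u v w : TangentSpace (𝓡 n) p) : ℝ :=
  coordCov₂ (coordTensor p metric) (coordTensor p α) (extChartAt (𝓡 n) p p)
    (coordVec p t) (coordVec p u) (coordVec p v) (coordVec p w)

end Manifold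

/-- `ξ` is a (local, smooth) lower support at `p` for `G`: it is smooth on an open neighbourhood
of `p`, where `ξ ≤ G`, and `ξ p = G p`. -/
def IsLowerSupportAt (n : ℕ) {M : Type*} [TopologicalSpace M]
    [ChartedSpace (EuclideanSpace ℝ (Fin n)) M] (ξ G : M → ℝ) (p : M) : Prop :=
  ∃ U : Set M, IsOpen U ∧ p ∈ U ∧ ContMDiffOn (𝓡 n) 𝓘(ℝ, ℝ) ∞ ξ U ∧
    (∀ x ∈ U, ξ x ≤ G x) ∧ ξ p = G p

end Subtrace

end

/-!
The eigenvalue sum `G_m` need not be differentiable, but Ky Fan's principle bounds it from above by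
smooth functions: for any frame `w₁, …, w_m` with Gram matrix `G`,
`G_m(α) ≤ ∑ₖₗ (G⁻¹)ₖₗ α(wₖ, wₗ)` (`Subtrace.subtrace_le_trace_gram_inverse_mul`), with equality at
`x₀` for `wₖ = eₖ`. A lower support `ξ` of `G_m` then lies below the right-hand side for every
moving frame that starts at `e₁, …, e_m`, and touches it at `x₀`. So the first derivatives agree and
the second derivatives are ordered (`Subtrace.HasJetTwo.le_of_eventually_le`).

The frame is chosen in the chart at `x₀`, along the line `y + t u`, where `u` is the coordinate
vector of `eᵢ`: the vectors `eₖ + t ∑ᵣ cₖᵣ eᵣ`, with `k ≤ m` and `r > D`, are moved along by parallel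
transport up to second order. In a parallel frame the derivatives of the components of a tensor are
its covariant derivatives (`Subtrace.hasJetTwo_transport`), and those of the metric vanish because
`∇g = 0` (`Subtrace.hasJetTwo_transport_metric`), so that the Gram matrix is
`1 + t² c cᵀ + o(t²)`. The second derivative of the right-hand side is therefore
`∑ₖ αₖₖ;ᵢᵢ + ∑ₖᵣ (4 cₖᵣ αₖᵣ;ᵢ + 2 (λᵣ - λₖ) cₖᵣ²)`, plus a first-order term due to the acceleration
`Γ(u, u)` of the line. The optimal `cₖᵣ = -αₖᵣ;ᵢ / (λᵣ - λₖ)` gives the double sum of the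
statement. The extra term equals `dξ(Γ(u, u))` by the first-order identity in the direction
`Γ(u, u)`, which is just the difference between the coordinate second derivative and the Hessian of
`ξ` (`Subtrace.coord_support_derivatives`).
-/

open Bundle

namespace Subtrace

/-! ### Second-order jets of functions of one variable -/

section Jets

open Filter Topology Asymptotics

/-- `f(t) = a + b t + (c / 2) t² + o(t²)` as `t → 0`; thus `c` is the second derivative, not the
Taylor coefficient. -/
def HasJetTwo (f : ℝ → ℝ) (a b c : ℝ) : Prop :=
  (fun t => f t - (a + b * t + c / 2 * t ^ 2)) =o[𝓝 0] fun t : ℝ => t ^ 2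

namespace HasJetTwo

variable {f f₁ f₂ : ℝ → ℝ} {a b c a₁ b₁ c₁ a₂ b₂ c₂ : ℝ}

theorem of_eq (h : HasJetTwo f a b c) (ha : a = a₁) (hb : b = b₁) (hc : c = c₁) :
    HasJetTwo f a₁ b₁ c₁ := ha ▸ hb ▸ hc ▸ h

theorem congr' (h : HasJetTwo f₁ a b c) (hf : f₁ =ᶠ[𝓝 0] f) : HasJetTwo f a b c :=
  IsLittleO.congr' h (hf.mono fun t ht => by simp only [ht]) EventuallyEq.rfl

theorem const (a : ℝ) : HasJetTwo (fun _ => a) a 0 0 := by simp [HasJetTwo]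

theorem identity : HasJetTwo (fun t => t) 0 1 0 := by simp [HasJetTwo]

theorem of_isLittleO (h : f =o[𝓝 0] fun t : ℝ => t ^ 2) : HasJetTwo f 0 0 0 := by
  simpa [HasJetTwo] using h

theorem add (h₁ : HasJetTwo f₁ a₁ b₁ c₁) (h₂ : HasJetTwo f₂ a₂ b₂ c₂) :
    HasJetTwo (fun t => f₁ t + f₂ t) (a₁ + a₂) (b₁ + b₂) (c₁ + c₂) :=
  (IsLittleO.add h₁ h₂).congr_left fun t => by ring

theorem sub (h₁ : HasJetTwo f₁ a₁ b₁ c₁) (h₂ : HasJetTwo f₂ a₂ b₂ c₂) :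
    HasJetTwo (fun t => f₁ t - f₂ t) (a₁ - a₂) (b₁ - b₂) (c₁ - c₂) :=
  (IsLittleO.sub h₁ h₂).congr_left fun t => by ring

theorem sum {ι : Type*} (s : Finset ι) {f : ι → ℝ → ℝ} {a b c : ι → ℝ}
    (h : ∀ k ∈ s, HasJetTwo (f k) (a k) (b k) (c k)) :
    HasJetTwo (fun t => ∑ k ∈ s, f k t) (∑ k ∈ s, a k) (∑ k ∈ s, b k) (∑ k ∈ s, c k) := by
  classical
  induction s using Finset.induction_on with
  | empty => simpa using const 0
  | insert k s hk ih =>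
    simp only [Finset.sum_insert hk]
    exact (h k (Finset.mem_insert_self k s)).add
      (ih fun j hj => h j (Finset.mem_insert_of_mem hj))

theorem isBigO_one (h : HasJetTwo f a b c) : f =O[𝓝 0] fun _ => (1 : ℝ) := by
  have h₁ : (fun t : ℝ => t ^ 2) =O[𝓝 0] fun _ => (1 : ℝ) :=
    ((continuous_pow 2).tendsto 0).isBigO_one ℝ
  have h₂ : (fun t : ℝ => a + b * t + c / 2 * t ^ 2) =O[𝓝 0] fun _ => (1 : ℝ) :=
    (show ContinuousAt _ _ by fun_prop).tendsto.isBigO_one ℝ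
  exact ((h.isBigO.trans h₁).add h₂).congr_left fun t => by ring

theorem mul (h₁ : HasJetTwo f₁ a₁ b₁ c₁) (h₂ : HasJetTwo f₂ a₂ b₂ c₂) :
    HasJetTwo (fun t => f₁ t * f₂ t) (a₁ * a₂) (a₁ * b₂ + b₁ * a₂)
      (a₁ * c₂ + 2 * (b₁ * b₂) + c₁ * a₂) := by
  have e₁ := IsLittleO.mul_isBigO h₁ h₂.isBigO_one
  have e₂ : (fun t : ℝ => (a₁ + b₁ * t + c₁ / 2 * t ^ 2) * (f₂ t - (a₂ + b₂ * t + c₂ / 2 * t ^ 2)))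
      =o[𝓝 0] fun t : ℝ => 1 * t ^ 2 :=
    ((show ContinuousAt _ _ by fun_prop).tendsto.isBigO_one ℝ).mul_isLittleO h₂
  have e₃ : (fun t : ℝ => t ^ 2 * (t * ((b₁ * c₂ + b₂ * c₁) / 2 + c₁ * c₂ / 4 * t)))
      =o[𝓝 0] fun t : ℝ => t ^ 2 * 1 := by
    refine (isBigO_refl _ _).mul_isLittleO ((isLittleO_one_iff ℝ).2 ?_)
    have : ContinuousAt (fun t : ℝ => t * ((b₁ * c₂ + b₂ * c₁) / 2 + c₁ * c₂ / 4 * t)) 0 := by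
      fun_prop
    simpa using this.tendsto
  simp only [mul_one, one_mul] at e₁ e₂ e₃
  exact ((e₁.add e₂).add e₃).congr_left fun t => by ring

theorem tendsto (h : HasJetTwo f a b c) : Tendsto f (𝓝 0) (𝓝 a) := by
  have h₁ : Tendsto (fun t : ℝ => t ^ 2) (𝓝 0) (𝓝 0) := by
    simpa using (continuous_pow 2).tendsto (0 : ℝ)
  have h₂ : Tendsto (fun t : ℝ => a + b * t + c / 2 * t ^ 2) (𝓝 0) (𝓝 a) := by
    have : ContinuousAt (fun t : ℝ => a + b * t + c / 2 * t ^ 2) 0 := by fun_prop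
    simpa using this.tendsto
  simpa using (h.isBigO.trans_tendsto h₁).add h₂

/-- Second-order Taylor expansion with Peano remainder. -/
theorem of_hasDerivAt {f' : ℝ → ℝ} (h : ∀ᶠ t in 𝓝 0, HasDerivAt f (f' t) t)
    (h' : HasDerivAt f' c 0) : HasJetTwo f (f 0) (f' 0) c := by
  rw [HasJetTwo, isLittleO_iff]
  intro ε hε
  have h₁ := (hasDerivAt_iff_isLittleO.1 h').def hε
  obtain ⟨δ, hδ, hball⟩ := Metric.eventually_nhds_iff_ball.1 (h.and h₁)
  refine Metric.eventually_nhds_iff_ball.2 ⟨δ, hδ, fun t ht => ?_⟩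
  have hsub : ∀ s ∈ Set.uIcc 0 t, s ∈ Metric.ball (0 : ℝ) δ ∧ |s| ≤ |t| := by
    intro s hs
    have : |s| ≤ |t| := by simpa using Set.abs_sub_left_of_mem_uIcc hs
    rw [Metric.mem_ball, dist_zero_right, Real.norm_eq_abs] at ht ⊢
    exact ⟨this.trans_lt ht, this⟩
  have key := (convex_uIcc (0 : ℝ) t).norm_image_sub_le_of_norm_hasDerivWithin_le
    (f := fun s => f s - (f 0 + f' 0 * s + c / 2 * s ^ 2)) (f' := fun s => f' s - (f' 0 + c * s))
    (C := ε * |t|) (x := 0) (y := t) (fun s hs => ?_) (fun s hs => ?_)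
    Set.left_mem_uIcc Set.right_mem_uIcc
  · simpa [sq, mul_assoc] using key
  · have hq : HasDerivAt (fun s : ℝ => f 0 + f' 0 * s + c / 2 * s ^ 2) (f' 0 + c * s) s := by
      have := (((hasDerivAt_id s).const_mul (f' 0)).const_add (f 0)).add
        ((hasDerivAt_pow 2 s).const_mul (c / 2))
      convert! this using 1
      simp; ring
    exact ((hball s (hsub s hs).1).1.sub hq).hasDerivWithinAt
  · have := (hball s (hsub s hs).1).2
    simp only [sub_zero, smul_eq_mul, Real.norm_eq_abs] at this ⊢
    calc |f' s - (f' 0 + c * s)| = |f' s - f' 0 - s * c| := by ring_nf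
      _ ≤ ε * |s| := this
      _ ≤ ε * |t| := by exact mul_le_mul_of_nonneg_left (hsub s hs).2 hε.le

/-- If a function lies below another and both agree at `0`, the first derivatives at `0` agree and
the second derivatives are ordered. -/
theorem le_of_eventually_le (h₁ : HasJetTwo f₁ a b₁ c₁) (h₂ : HasJetTwo f₂ a b₂ c₂)
    (hle : ∀ᶠ t in 𝓝 0, f₁ t ≤ f₂ t) : b₁ = b₂ ∧ c₁ ≤ c₂ := by
  have hd := h₂.sub h₁
  set b := b₂ - b₁ with hb
  set c := c₂ - c₁ with hc
  have hpos : ∀ ε > 0, ∀ᶠ t in 𝓝 (0 : ℝ), 0 ≤ b * t + c / 2 * t ^ 2 + ε * t ^ 2 := by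
    intro ε hε
    filter_upwards [IsLittleO.def hd hε, hle] with t ht htle
    simp only [Real.norm_eq_abs, abs_pow, sq_abs, sub_self, zero_add] at ht
    linarith [le_of_abs_le ht]
  have hb0 : b = 0 := by
    have hmin : IsLocalMin (fun t : ℝ => b * t + c / 2 * t ^ 2 + 1 * t ^ 2) 0 := by
      filter_upwards [hpos 1 one_pos] with t ht
      simpa using ht
    have hder : HasDerivAt (fun t : ℝ => b * t + c / 2 * t ^ 2 + 1 * t ^ 2) b 0 := by
      have := (((hasDerivAt_id (0 : ℝ)).const_mul b).add
        ((hasDerivAt_pow 2 (0 : ℝ)).const_mul (c / 2))).add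
        ((hasDerivAt_pow 2 (0 : ℝ)).const_mul 1)
      convert! this using 1
      simp
    exact hmin.hasDerivAt_eq_zero hder
  refine ⟨by linarith, ?_⟩
  have hc0 : 0 ≤ c := by
    by_contra! hneg
    have h := hpos (-c / 4) (by linarith)
    obtain ⟨t, ht, ht0⟩ := ((h.filter_mono nhdsWithin_le_nhds).and
      (self_mem_nhdsWithin (a := (0 : ℝ)) (s := {0}ᶜ))).exists
    have : 0 < t ^ 2 := sq_pos_of_ne_zero (by simpa using ht0)
    rw [hb0] at ht
    nlinarith
  linarith

end HasJetTwo
end Jets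

/-! ### Ky Fan's principle for the subtrace -/

section KyFan

open scoped Matrix

variable {V : Type*} [NormedAddCommGroup V] [InnerProductSpace ℝ V]

/-- If `H` is the inverse Gram matrix of `w`, the quantity below is the squared length of the
projection of the unit vector `q` to the span of `w`. -/
theorem gram_inverse_weight_mem_Icc {ι : Type*} [Fintype ι] [DecidableEq ι] (w : ι → V)
    (H : Matrix ι ι ℝ) (hH : Matrix.of (fun k l => inner ℝ (w k) (w l)) * H = 1)
    (q : V) (hq : ‖q‖ = 1) :
    ∑ k, ∑ l, H k l * (inner ℝ q (w k) * inner ℝ q (w l)) ∈ Set.Icc (0 : ℝ) 1 := by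
  set x : ι → ℝ := fun k => inner ℝ q (w k) with hx
  set y : ι → ℝ := H *ᵥ x with hy
  set z : V := ∑ k, y k • w k with hz
  have hp : ∑ k, ∑ l, H k l * (x k * x l) = ∑ k, y k * x k := by
    refine Finset.sum_congr rfl fun k _ => ?_
    rw [hy, Matrix.mulVec, dotProduct, Finset.sum_mul]
    exact Finset.sum_congr rfl fun l _ => by ring
  have hqz : inner ℝ q z = ∑ k, y k * x k := by
    simp [hz, inner_sum, inner_smul_right, hx]
  have hGy : Matrix.of (fun k l => inner ℝ (w k) (w l)) *ᵥ y = x := by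
    rw [hy, Matrix.mulVec_mulVec, hH, Matrix.one_mulVec]
  have hzz : ‖z‖ ^ 2 = ∑ k, y k * x k := by
    rw [← real_inner_self_eq_norm_sq]
    conv_lhs => rw [hz, sum_inner]
    refine Finset.sum_congr rfl fun k _ => ?_
    rw [real_inner_smul_left, ← hGy, Matrix.mulVec, dotProduct, inner_sum]
    simp [real_inner_smul_right, mul_comm]
  have hcs : inner ℝ q z ≤ ‖z‖ := by simpa [hq] using real_inner_le_norm q z
  change ∑ k, ∑ l, H k l * (x k * x l) ∈ _
  rw [hp, ← hzz]
  rw [hqz, ← hzz] at hcs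
  refine ⟨by positivity, ?_⟩
  nlinarith [norm_nonneg z]

/-- **Ky Fan's minimum principle** for a frame `w` that need not be orthonormal: the trace of `B` on
the span of `w`, computed with the inverse `H` of the Gram matrix, is at least the sum of the `μ j`
over `S`, where `τ` separates the `μ j` with `j ∈ S` from the others. -/
theorem sum_eigenvalues_le_trace_gram_inverse_mul {J : Type*} [Fintype J]
    (q : OrthonormalBasis J ℝ V) (B : V →L[ℝ] V →L[ℝ] ℝ) (μ : J → ℝ)
    (hB : ∀ j v, B (q j) v = μ j * inner ℝ (q j) v) (S : Finset J) (τ : ℝ)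
    (hS : ∀ j ∈ S, μ j ≤ τ) (hS' : ∀ j ∉ S, τ ≤ μ j)
    {ι : Type*} [Fintype ι] [DecidableEq ι] (hcard : Fintype.card ι = S.card) (w : ι → V)
    (H : Matrix ι ι ℝ) (hH : Matrix.of (fun k l => inner ℝ (w k) (w l)) * H = 1) :
    ∑ j ∈ S, μ j ≤ ∑ k, ∑ l, H k l * B (w k) (w l) := by
  classical
  set p : J → ℝ := fun j => ∑ k, ∑ l, H k l * (inner ℝ (q j) (w k) * inner ℝ (q j) (w l)) with hp
  have hp01 : ∀ j, p j ∈ Set.Icc (0 : ℝ) 1 := fun j =>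
    gram_inverse_weight_mem_Icc w H hH (q j) (q.orthonormal.1 j)
  have hswap : ∀ c : J → ℝ, ∑ j, c j * p j = ∑ k, ∑ l, H k l *
      ∑ j, c j * (inner ℝ (q j) (w k) * inner ℝ (q j) (w l)) := by
    intro c
    simp only [hp, Finset.mul_sum]
    rw [Finset.sum_comm]
    refine Finset.sum_congr rfl fun k _ => ?_
    rw [Finset.sum_comm]
    exact Finset.sum_congr rfl fun l _ => Finset.sum_congr rfl fun j _ => by ring
  have hBw : ∀ k l, B (w k) (w l) =
      ∑ j, μ j * (inner ℝ (q j) (w k) * inner ℝ (q j) (w l)) := by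
    intro k l
    conv_lhs => rw [← q.sum_repr' (w k)]
    simp only [map_sum, map_smul, sum_apply, smul_apply,
      hB, smul_eq_mul]
    exact Finset.sum_congr rfl fun j _ => by ring
  have htrace : ∑ j, p j = S.card := by
    have h := hswap fun _ => 1
    simp only [one_mul] at h
    have hinner : ∀ k l, ∑ j, inner ℝ (q j) (w k) * inner ℝ (q j) (w l)
        = inner ℝ (w l) (w k) := by
      intro k l
      rw [← q.sum_inner_mul_inner (w l) (w k)]
      exact Finset.sum_congr rfl fun j _ => by rw [real_inner_comm (q j) (w l)]; ring
    rw [h]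
    have htr : Matrix.trace (Matrix.of (fun k l => inner ℝ (w k) (w l)) * H) = S.card := by
      rw [hH, Matrix.trace_one, hcard]
    rw [← htr, Matrix.trace, Finset.sum_comm]
    refine Finset.sum_congr rfl fun l _ => ?_
    rw [Matrix.diag_apply, Matrix.mul_apply]
    exact Finset.sum_congr rfl fun k _ => by rw [hinner, Matrix.of_apply]; ring
  have hmain : ∑ k, ∑ l, H k l * B (w k) (w l) = ∑ j, μ j * p j := by
    rw [hswap]; simp only [hBw]
  -- Compare `∑ (μ j - τ) p j` with `∑ (μ j - τ) 1_S j` term by term.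
  have hterm : ∀ j, (if j ∈ S then μ j - τ else 0) ≤ (μ j - τ) * p j := by
    intro j
    obtain ⟨h0, h1⟩ := hp01 j
    split_ifs with hj
    · nlinarith [hS j hj]
    · exact mul_nonneg (sub_nonneg.2 (hS' j hj)) h0
  have hsum := Finset.sum_le_sum fun j (_ : j ∈ Finset.univ) => hterm j
  rw [Finset.sum_ite_mem, Finset.univ_inter] at hsum
  simp only [sub_mul, Finset.sum_sub_distrib, Finset.sum_const, nsmul_eq_mul,
    ← Finset.mul_sum, htrace] at hsum
  rw [hmain]
  linarith

theorem sum_eigenvalues_le_sum_of_orthonormal {J : Type*} [Fintype J]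
    (q : OrthonormalBasis J ℝ V) (B : V →L[ℝ] V →L[ℝ] ℝ) (μ : J → ℝ)
    (hB : ∀ j v, B (q j) v = μ j * inner ℝ (q j) v) (S : Finset J) (τ : ℝ)
    (hS : ∀ j ∈ S, μ j ≤ τ) (hS' : ∀ j ∉ S, τ ≤ μ j)
    {ι : Type*} [Fintype ι] (hcard : Fintype.card ι = S.card) {w : ι → V}
    (hw : Orthonormal ℝ w) : ∑ j ∈ S, μ j ≤ ∑ k, B (w k) (w k) := by
  classical
  have h := sum_eigenvalues_le_trace_gram_inverse_mul q B μ hB S τ hS hS' hcard w 1 (by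
    ext k l
    simp [orthonormal_iff_ite.1 hw, Matrix.one_apply])
  simpa [Matrix.one_apply] using h

variable [FiniteDimensional ℝ V]

/-- The orthonormal eigenbasis of `B♯` belonging to the increasing list `eigenvalue B hB`. -/
noncomputable def eigenbasis (B : V →L[ℝ] V →L[ℝ] ℝ) (hB : ∀ v w, B v w = B w v) :
    OrthonormalBasis (Fin (Module.finrank ℝ V)) ℝ V :=
  ((sharp_isSymmetric hB).eigenvectorBasis rfl).reindex Fin.revPerm

theorem apply_eigenbasis (B : V →L[ℝ] V →L[ℝ] ℝ) (hB : ∀ v w, B v w = B w v)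
    (j : Fin (Module.finrank ℝ V)) (v : V) :
    B (eigenbasis B hB j) v = eigenvalue B hB j * inner ℝ (eigenbasis B hB j) v := by
  rw [← inner_sharp]
  simp [eigenbasis, eigenvalue, LinearMap.IsSymmetric.apply_eigenvectorBasis,
    real_inner_smul_left]

/-- The `m`-th smallest value separates the first `m` values of a monotone list from the others. -/
theorem exists_threshold_of_monotone {N m : ℕ} {μ : Fin N → ℝ} (hμ : Monotone μ) (hm : 1 ≤ m)
    (hmN : m ≤ N) : ∃ τ, (∀ j ∈ Finset.univ.filter fun j : Fin N => j.val < m, μ j ≤ τ) ∧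
      ∀ j ∉ Finset.univ.filter fun j : Fin N => j.val < m, τ ≤ μ j := by
  refine ⟨μ ⟨m - 1, by omega⟩, fun j hj => hμ ?_, fun j hj => hμ ?_⟩
  · simp only [Finset.mem_filter, Finset.mem_univ, true_and] at hj
    rw [Fin.le_def]; simp only; omega
  · simp only [Finset.mem_filter, Finset.mem_univ, true_and, not_lt] at hj
    rw [Fin.le_def]; simp only; omega

theorem card_filter_val_lt {N m : ℕ} (hmN : m ≤ N) :
    (Finset.univ.filter fun j : Fin N => j.val < m).card = m := by
  rw [Fin.card_filter_val_lt, min_eq_right hmN]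

theorem subtrace_le_trace_gram_inverse_mul {m : ℕ} (hm : 1 ≤ m) (hmV : m ≤ Module.finrank ℝ V)
    (B : V →L[ℝ] V →L[ℝ] ℝ) (hB : ∀ v w, B v w = B w v)
    {ι : Type*} [Fintype ι] [DecidableEq ι] (hcard : Fintype.card ι = m) (w : ι → V)
    (H : Matrix ι ι ℝ) (hH : Matrix.of (fun k l => inner ℝ (w k) (w l)) * H = 1) :
    subtrace m B hB ≤ ∑ k, ∑ l, H k l * B (w k) (w l) := by
  obtain ⟨τ, h₁, h₂⟩ := exists_threshold_of_monotone (eigenvalue_monotone B hB) hm hmV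
  exact sum_eigenvalues_le_trace_gram_inverse_mul (eigenbasis B hB) B _ (apply_eigenbasis B hB)
    _ τ h₁ h₂ (by rw [hcard, card_filter_val_lt hmV]) w H hH

/-- Ky Fan's principle applied in both directions shows that the subtrace can be read off from any
orthonormal eigenbasis listed with increasing eigenvalues. -/
theorem subtrace_eq_sum_of_monotone_eigenbasis {m : ℕ} (hm : 1 ≤ m) {N : ℕ} (hmN : m ≤ N)
    (B : V →L[ℝ] V →L[ℝ] ℝ) (hB : ∀ v w, B v w = B w v) (e : OrthonormalBasis (Fin N) ℝ V)
    (lam : Fin N → ℝ) (hlam : Monotone lam) (he : ∀ k, sharp B (e k) = lam k • e k) :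
    subtrace m B hB = ∑ k : Fin N with k.val < m, lam k := by
  have hN : Module.finrank ℝ V = N := by
    rw [Module.finrank_eq_card_basis e.toBasis, Fintype.card_fin]
  have hBe : ∀ j v, B (e j) v = lam j * inner ℝ (e j) v := fun j v => by
    rw [← inner_sharp, he, real_inner_smul_left]
  have hdiag : ∀ {K : ℕ} (f : OrthonormalBasis (Fin K) ℝ V) (μ : Fin K → ℝ),
      (∀ j v, B (f j) v = μ j * inner ℝ (f j) v) →
      ∑ k : {k : Fin K // k.val < m}, B (f k) (f k) = ∑ k : Fin K with k.val < m, μ k := by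
    intro K f μ hf
    rw [Finset.sum_subtype (p := fun k : Fin K => k.val < m) _ (by simp)]
    exact Finset.sum_congr rfl fun k _ => by simp [hf]
  have hcard : ∀ K : ℕ, m ≤ K → Fintype.card {k : Fin K // k.val < m} = m := fun K hK => by
    rw [Fintype.card_subtype, card_filter_val_lt hK]
  apply le_antisymm
  · obtain ⟨τ, h₁, h₂⟩ :=
      exists_threshold_of_monotone (eigenvalue_monotone B hB) hm (hmN.trans_eq hN.symm)
    rw [← hdiag e lam hBe]
    exact sum_eigenvalues_le_sum_of_orthonormal (eigenbasis B hB) B _ (apply_eigenbasis B hB)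
      _ τ h₁ h₂ (by rw [hcard N hmN, card_filter_val_lt (hmN.trans_eq hN.symm)])
      (e.orthonormal.comp _ Subtype.val_injective)
  · obtain ⟨τ, h₁, h₂⟩ := exists_threshold_of_monotone hlam hm hmN
    rw [subtrace, ← hdiag _ _ (apply_eigenbasis B hB)]
    exact sum_eigenvalues_le_sum_of_orthonormal e B _ hBe
      _ τ h₁ h₂ (by rw [hcard _ (hmN.trans_eq hN.symm), card_filter_val_lt hmN])
      ((eigenbasis B hB).orthonormal.comp _ Subtype.val_injective)

end KyFan

/-! ### Second-order parallel transport in coordinates -/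

section Coordinates

open Filter Topology

variable {E : Type*} [NormedAddCommGroup E] [NormedSpace ℝ E]

/- The next facts have the target space `F` as a variable, which keeps the search for norms on
iterated spaces of continuous linear maps short. -/

section VariableTarget

variable {X F : Type*} [NormedAddCommGroup X] [NormedSpace ℝ X] [NormedAddCommGroup F]
  [NormedSpace ℝ F]

theorem fderiv_clm_apply_const {b : E → X →L[ℝ] F} {y : E} (hb : DifferentiableAt ℝ b y) (v : X)
    (u : E) : fderiv ℝ (fun z => b z v) y u = fderiv ℝ b y u v := by
  rw [(hb.hasFDerivAt.clm_apply (hasFDerivAt_const v y)).fderiv]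
  simp

theorem contDiffAt_fderiv_apply_const {b : E → F} {y : E} (hb : ContDiffAt ℝ ∞ b y) (u : E) :
    ContDiffAt ℝ ∞ (fun z => fderiv ℝ b z u) y :=
  (hb.fderiv_right (by simp)).clm_apply contDiffAt_const

theorem hasDerivAt_comp_line {b : E → F} {y u : E} {t : ℝ}
    (hb : DifferentiableAt ℝ b (y + t • u)) :
    HasDerivAt (fun s : ℝ => b (y + s • u)) (fderiv ℝ b (y + t • u) u) t := by
  have hline : HasDerivAt (fun t : ℝ => y + t • u) u t := by
    simpa using ((hasDerivAt_id t).smul_const u).const_add y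
  exact hb.hasFDerivAt.comp_hasDerivAt t hline

theorem hasDerivAt_comp_line_zero {b : E → F} {y : E} (hb : DifferentiableAt ℝ b y) (u : E) :
    HasDerivAt (fun s : ℝ => b (y + s • u)) (fderiv ℝ b y u) 0 := by
  have h₀ : y + (0 : ℝ) • u = y := by simp
  rw [← h₀] at hb
  have h := hasDerivAt_comp_line hb
  rwa [h₀] at h

theorem tendsto_line (y u : E) : Tendsto (fun t : ℝ => y + t • u) (𝓝 0) (𝓝 y) := by
  have : Continuous fun t : ℝ => y + t • u := by fun_prop
  simpa using this.tendsto 0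

theorem eventually_hasDerivAt_comp_line {b : E → F} {y : E} (hb : ContDiffAt ℝ ∞ b y) (u : E) :
    ∀ᶠ t in 𝓝 (0 : ℝ), HasDerivAt (fun s : ℝ => b (y + s • u)) (fderiv ℝ b (y + t • u) u) t := by
  have h : ∀ᶠ z in 𝓝 y, DifferentiableAt ℝ b z :=
    ((hb.of_le (m := 1) (by simp)).eventually (by simp)).mono fun z hz =>
      hz.differentiableAt (by simp)
  exact ((tendsto_line y u).eventually h).mono fun t ht => hasDerivAt_comp_line ht

theorem hasJetTwo_comp_line {f : E → ℝ} {y : E} (hf : ContDiffAt ℝ ∞ f y) (u : E) :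
    HasJetTwo (fun t => f (y + t • u)) (f y) (fderiv ℝ f y u)
      (fderiv ℝ (fderiv ℝ f) y u u) := by
  have hd := (contDiffAt_fderiv_apply_const hf u).differentiableAt (by simp)
  refine (HasJetTwo.of_hasDerivAt (eventually_hasDerivAt_comp_line hf u)
    (hasDerivAt_comp_line_zero hd u)).of_eq (by simp) (by simp) ?_
  exact fderiv_clm_apply_const ((hf.fderiv_right (m := ∞) (by simp)).differentiableAt (by simp))
    u u

theorem contDiffAt_clm_of_apply [FiniteDimensional ℝ X] {n : WithTop ℕ∞} {b : E → X →L[ℝ] F}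
    {y : E} (hb : ∀ v, ContDiffAt ℝ n (fun z => b z v) y) : ContDiffAt ℝ n b y := by
  set β := Module.finBasis ℝ X
  have hsum : b = fun z => ∑ i, ContinuousLinearMap.smulRightL ℝ X F
      (LinearMap.toContinuousLinearMap (β.coord i)) (b z (β i)) := by
    ext z v
    have hv := congrArg (b z) (β.sum_repr v)
    rw [map_sum] at hv
    rw [← hv]
    simp [sum_apply]
  rw [hsum]
  exact ContDiffAt.sum fun i _ => (ContinuousLinearMap.contDiff _).contDiffAt.comp y (hb (β i))

end VariableTarget

theorem fderiv_symm_of_symm {b : E → E →L[ℝ] E →L[ℝ] ℝ} {y : E} (hb : DifferentiableAt ℝ b y)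
    (hsymm : ∀ z v w, b z v w = b z w v) (u v w : E) :
    fderiv ℝ b y u v w = fderiv ℝ b y u w v := by
  have h : ∀ v w, fderiv ℝ (fun z => b z v w) y u = fderiv ℝ b y u v w := fun v w => by
    rw [fderiv_clm_apply_const (hb.clm_apply (differentiableAt_const v)),
      fderiv_clm_apply_const hb]
  rw [← h, ← h]
  simp only [hsymm _ v w]

theorem coordCov_symm (g : E → E →L[ℝ] E →L[ℝ] ℝ) {a : E → E →L[ℝ] E →L[ℝ] ℝ} {y : E}
    (ha : DifferentiableAt ℝ a y) (hsymm : ∀ z v w, a z v w = a z w v) (u v w : E) :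
    coordCov g a y u v w = coordCov g a y u w v := by
  rw [coordCov_apply, coordCov_apply, fderiv_symm_of_symm ha hsymm u v w,
    hsymm y (christoffel g y u v), hsymm y v]
  ring

/-- The Levi-Civita connection is compatible with the metric. -/
theorem coordCov_metric_eq_zero {g : E → E →L[ℝ] E →L[ℝ] ℝ} {y : E}
    (hg : DifferentiableAt ℝ g y) (hinv : (g y).IsInvertible)
    (hsymm : ∀ z v w, g z v w = g z w v) (u : E) : coordCov g g y u = 0 := by
  have hΓ : ∀ v w, g y (christoffel g y u v) w = christoffelFirst g y u v w := fun v w => by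
    rw [christoffel, ContinuousLinearMap.comp_apply, hinv.self_apply_inverse]
  ext v w
  rw [coordCov_apply, hΓ, hsymm y v, hΓ, christoffelFirst_apply, christoffelFirst_apply,
    fderiv_symm_of_symm hg hsymm u w v, fderiv_symm_of_symm hg hsymm w u v]
  simp only [zero_apply]
  ring

theorem contDiffAt_christoffel [FiniteDimensional ℝ E] {g : E → E →L[ℝ] E →L[ℝ] ℝ} {y : E}
    (hg : ContDiffAt ℝ ∞ g y) (hinv : (g y).IsInvertible) (u : E) :
    ContDiffAt ℝ ∞ (fun z => christoffel g z u) y := by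
  have : CompleteSpace E := FiniteDimensional.complete ℝ E
  have hdg : ∀ u v w, ContDiffAt ℝ ∞ (fun z => fderiv ℝ g z u v w) y := fun u v w =>
    ((contDiffAt_fderiv_apply_const hg u).clm_apply contDiffAt_const).clm_apply contDiffAt_const
  have hfirst : ContDiffAt ℝ ∞ (fun z => christoffelFirst g z u) y := by
    refine contDiffAt_clm_of_apply fun v => contDiffAt_clm_of_apply fun w => ?_
    simp only [christoffelFirst_apply]
    exact contDiffAt_const.mul (((hdg u v w).add (hdg v u w)).sub (hdg w u v))
  exact (hinv.contDiffAt_map_inverse.comp y hg).clm_comp hfirst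

theorem contDiffAt_coordCov [FiniteDimensional ℝ E] {g a : E → E →L[ℝ] E →L[ℝ] ℝ} {y : E}
    (hg : ContDiffAt ℝ ∞ g y) (hinv : (g y).IsInvertible) (ha : ContDiffAt ℝ ∞ a y) (u : E) :
    ContDiffAt ℝ ∞ (fun z => coordCov g a z u) y := by
  have hN := contDiffAt_christoffel hg hinv u
  refine contDiffAt_clm_of_apply fun v => contDiffAt_clm_of_apply fun w => ?_
  simp only [coordCov_apply]
  have hc : ∀ x : E, ContDiffAt ℝ ∞ (fun _ : E => x) y := fun _ => contDiffAt_const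
  exact ((((contDiffAt_fderiv_apply_const ha u).clm_apply (hc v)).clm_apply (hc w)).sub
    ((ha.clm_apply (hN.clm_apply (hc v))).clm_apply (hc w))).sub
    ((ha.clm_apply (hc v)).clm_apply (hN.clm_apply (hc w)))

/-- The quadratic polynomial `Q(t) = 1 - t N₀ + (t² / 2) (N₀² - N₁)`. When `N₀ = N(0)` and
`N₁ = N'(0)`, it satisfies `Q(0) = 1` and `Q' + N Q = o(t)`, so that it agrees to second order with
the parallel transport of a connection whose matrix along the curve is `N`. -/
noncomputable def approxTransport (N₀ N₁ : E →L[ℝ] E) (t : ℝ) : E →L[ℝ] E :=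
  ContinuousLinearMap.id ℝ E - t • N₀ + (t ^ 2 / 2) • (N₀ ∘L N₀ - N₁)

/-- In a frame that is parallel to second order, differentiating the components of a bilinear form
amounts to covariant differentiation. Here `C = a' - a(N ·, ·) - a(·, N ·)` is the covariant
derivative along the curve and `C₁` its ordinary derivative at `0`. -/
theorem hasJetTwo_approxTransport {a a' : ℝ → E →L[ℝ] E →L[ℝ] ℝ} {N : ℝ → E →L[ℝ] E}
    {N₁ : E →L[ℝ] E} {C : ℝ → E →L[ℝ] E →L[ℝ] ℝ} {C₁ : E →L[ℝ] E →L[ℝ] ℝ}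
    (ha : ∀ᶠ t in 𝓝 0, HasDerivAt a (a' t) t) (hN : HasDerivAt N N₁ 0)
    (hC : HasDerivAt C C₁ 0)
    (hCN : ∀ t v w, C t v w = a' t v w - a t (N t v) w - a t v (N t w)) (v w : E) :
    HasJetTwo (fun t => pullback (a t) (approxTransport (N 0) N₁ t) v w) (a 0 v w) (C 0 v w)
      (C₁ v w - C 0 (N 0 v) w - C 0 v (N 0 w)) := by
  set q : E → ℝ → E := fun v t => approxTransport (N 0) N₁ t v with hq
  set r : E → ℝ → E := fun v t => -N 0 v + t • (N 0 (N 0 v) - N₁ v) + N t (q v t) with hr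
  have hq0 : ∀ v, q v 0 = v := fun v => by simp [hq, approxTransport]
  have hr0 : ∀ v, r v 0 = 0 := fun v => by simp [hr, hq0]
  have hqd : ∀ v t, HasDerivAt (q v) (-N 0 v + t • (N 0 (N 0 v) - N₁ v)) t := by
    intro v t
    have h₁ := (((hasDerivAt_id t).smul_const (N 0 v)).const_sub v).add
      ((((hasDerivAt_pow 2 t).div_const 2)).smul_const (N 0 (N 0 v) - N₁ v))
    convert! h₁ using 1
    simp
  have hqd0 : ∀ v, HasDerivAt (q v) (-N 0 v) 0 := fun v => by simpa using hqd v 0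
  have hrd : ∀ v, HasDerivAt (r v) 0 0 := by
    intro v
    have h₁ := ((((hasDerivAt_id (0 : ℝ)).smul_const (N 0 (N 0 v) - N₁ v)).const_add
      (-N 0 v))).add (hN.clm_apply (hqd0 v))
    convert! h₁ using 1
    simp only [hq0, one_smul, map_neg]
    abel
  have ha0 := ha.self_of_nhds
  refine (HasJetTwo.of_hasDerivAt (f' := fun t => C t (q v t) (q w t) + a t (r v t) (q w t) +
    a t (q v t) (r w t)) (c := C₁ v w - C 0 (N 0 v) w - C 0 v (N 0 w)) ?_ ?_).of_eq ?_ ?_ rfl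
  · filter_upwards [ha] with t hat
    have h₁ := (hat.clm_apply (hqd v t)).clm_apply (hqd w t)
    convert! h₁ using 1
    simp only [hr, hCN, map_add, add_apply]
    ring
  · have h₁ := (((hC.clm_apply (hqd0 v)).clm_apply (hqd0 w)).add
      ((ha0.clm_apply (hrd v)).clm_apply (hqd0 w))).add
      ((ha0.clm_apply (hqd0 v)).clm_apply (hrd w))
    convert! h₁ using 1
    simp [hq0, hr0]
    ring
  · change a 0 (q v 0) (q w 0) = _
    rw [hq0, hq0]
  · simp [hq0, hr0]

/-- Parallel transport along the line `t ↦ y + t u`, up to second order in `t`. -/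
noncomputable def transport (g : E → E →L[ℝ] E →L[ℝ] ℝ) (y u : E) : ℝ → E →L[ℝ] E :=
  approxTransport (christoffel g y u) (fderiv ℝ (fun z => christoffel g z u) y u)

set_option synthInstance.maxHeartbeats 100000 in
/-- The summand `∇_{Γ(u,u)} a` appears because the line `t ↦ y + t u` has acceleration `Γ(u, u)`. -/
theorem hasJetTwo_transport [FiniteDimensional ℝ E] {g a : E → E →L[ℝ] E →L[ℝ] ℝ} {y : E}
    (hg : ContDiffAt ℝ ∞ g y) (hinv : (g y).IsInvertible) (ha : ContDiffAt ℝ ∞ a y)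
    (u v w : E) :
    HasJetTwo (fun t => pullback (a (y + t • u)) (transport g y u t) v w)
      (a y v w) (coordCov g a y u v w)
      (coordCov₂ g a y u u v w + coordCov g a y (christoffel g y u u) v w) := by
  have had := eventually_hasDerivAt_comp_line ha u
  have hCd := (contDiffAt_coordCov hg hinv ha u).differentiableAt (by simp)
  have hN := hasDerivAt_comp_line_zero
    ((contDiffAt_christoffel hg hinv u).differentiableAt (by simp)) u
  have hC := hasDerivAt_comp_line_zero hCd u
  have ht0 : y + (0 : ℝ) • u = y := by simp
  have h := hasJetTwo_approxTransport had hN hC (fun t v w => coordCov_apply _ _ _ _ _ _) v w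
  simp only [ht0] at h
  refine h.of_eq rfl rfl ?_
  have hvw : fderiv ℝ (fun z => coordCov g a z u v w) y u
      = fderiv ℝ (fun z => coordCov g a z u) y u v w := by
    rw [fderiv_clm_apply_const (hCd.clm_apply (differentiableAt_const v)),
      fderiv_clm_apply_const hCd]
  rw [coordCov₂, hvw]
  ring

/-- Since `∇g = 0`, parallel frames keep their inner products up to second order. -/
theorem hasJetTwo_transport_metric [FiniteDimensional ℝ E] {g : E → E →L[ℝ] E →L[ℝ] ℝ} {y : E}
    (hg : ContDiffAt ℝ ∞ g y) (hinv : (g y).IsInvertible)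
    (hsymm : ∀ z v w, g z v w = g z w v) (u v w : E) :
    HasJetTwo (fun t => pullback (g (y + t • u)) (transport g y u t) v w) (g y v w) 0 0 := by
  have hev : ∀ᶠ z in 𝓝 y, ∀ u, coordCov g g z u = 0 := by
    have h₁ : ∀ᶠ z in 𝓝 y, (g z).IsInvertible := by
      obtain ⟨e, he⟩ := hinv
      have := hg.continuousAt.eventually_mem (by rw [← he]; exact e.nhds)
      exact this.mono fun z hz => hz
    filter_upwards [h₁, (hg.of_le (m := 1) (by simp)).eventually (by simp)] with z hz hgz u
    exact coordCov_metric_eq_zero (hgz.differentiableAt (by simp)) hz hsymm u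
  have h0 := hev.self_of_nhds
  refine (hasJetTwo_transport hg hinv hg u v w).of_eq rfl (by simp [h0]) ?_
  have hd : fderiv ℝ (fun z => coordCov g g z u v w) y = 0 := by
    have : (fun z => coordCov g g z u v w) =ᶠ[𝓝 y] fun _ => 0 :=
      hev.mono fun z hz => by simp [hz]
    rw [this.fderiv_eq]; simp
  simp [coordCov₂, hd, h0]

theorem HasJetTwo.bilinear_affine {β : ℝ → E →L[ℝ] E →L[ℝ] ℝ} {b₀ b₁ b₂ : E → E → ℝ}
    (h : ∀ v w, HasJetTwo (fun t => β t v w) (b₀ v w) (b₁ v w) (b₂ v w)) (v v' w w' : E) :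
    HasJetTwo (fun t => β t (v + t • v') (w + t • w')) (b₀ v w)
      (b₁ v w + b₀ v w' + b₀ v' w)
      (b₂ v w + 2 * (b₁ v w' + b₁ v' w) + 2 * b₀ v' w') := by
  refine HasJetTwo.congr' (f₁ := fun t => β t v w + t * β t v w' + t * β t v' w +
    t * (t * β t v' w')) ?_ (.of_forall fun t => ?_)
  · exact ((((h v w).add (identity.mul (h v w'))).add (identity.mul (h v' w))).add
      (identity.mul (identity.mul (h v' w')))).of_eq (by ring) (by ring) (by ring)
  · simp only [map_add, map_smul, add_apply, smul_apply, smul_eq_mul]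
    ring

end Coordinates

/-! ### The jet of an inverse Gram matrix -/

section GramInverse

open Filter Topology Asymptotics

variable {ι : Type*} [Fintype ι] [DecidableEq ι]

/-- A matrix with jet `1 + (s / 2) t²` has an inverse near `t = 0`, with jet `1 - (s / 2) t²`. -/
theorem HasJetTwo.exists_matrix_inverse {G : ℝ → Matrix ι ι ℝ} {s : ι → ι → ℝ}
    (h : ∀ k l, HasJetTwo (fun t => G t k l) (if k = l then 1 else 0) 0 (s k l)) :
    ∃ H : ℝ → Matrix ι ι ℝ, (∀ᶠ t in 𝓝 0, G t * H t = 1) ∧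
      ∀ k l, HasJetTwo (fun t => H t k l) (if k = l then 1 else 0) 0 (-s k l) := by
  have hG : Tendsto G (𝓝 0) (𝓝 1) := by
    refine tendsto_pi_nhds.2 fun k => tendsto_pi_nhds.2 fun l => ?_
    rw [Matrix.one_apply]
    exact (h k l).tendsto
  have hdet : Tendsto (fun t => (G t).det) (𝓝 0) (𝓝 1) := by
    have := ((continuous_id.matrix_det).tendsto (1 : Matrix ι ι ℝ)).comp hG
    rwa [id, Matrix.det_one] at this
  have hunit : ∀ᶠ t in 𝓝 0, IsUnit (G t).det :=
    (hdet.eventually_ne one_ne_zero).mono fun t ht => isUnit_iff_ne_zero.2 ht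
  have hGH : ∀ᶠ t in 𝓝 0, G t * (G t)⁻¹ = 1 :=
    hunit.mono fun t ht => Matrix.mul_nonsing_inv _ ht
  refine ⟨fun t => (G t)⁻¹, hGH, fun k l => ?_⟩
  have hbdd : ∀ k l, (fun t => (G t)⁻¹ k l) =O[𝓝 0] fun _ => (1 : ℝ) := by
    intro k l
    have hadj : Tendsto (fun t => (G t).adjugate k l) (𝓝 0) (𝓝 ((1 : Matrix ι ι ℝ).adjugate k l)) :=
      (((continuous_id.matrix_adjugate).matrix_elem k l).tendsto (1 : Matrix ι ι ℝ)).comp hG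
    have := (hdet.inv₀ one_ne_zero).mul hadj
    refine (this.isBigO_one ℝ).congr_left fun t => ?_
    rw [Matrix.inv_def, Ring.inverse_eq_inv', Matrix.smul_apply, smul_eq_mul]
  have hd : ∀ k l, HasJetTwo (fun t => (1 - G t) k l) 0 0 (-s k l) := fun k l => by
    refine ((HasJetTwo.const ((1 : Matrix ι ι ℝ) k l)).sub (h k l)).of_eq ?_ ?_ ?_ <;>
      simp [Matrix.one_apply]
  have hsq : ∀ i j, (fun t => (1 - G t) k i * (1 - G t) i j * (G t)⁻¹ j l)
      =o[𝓝 0] fun t : ℝ => t ^ 2 := by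
    intro i j
    have h₁ := (hd k i).mul (hd i j)
    have h₂ : (fun t => (1 - G t) k i * (1 - G t) i j) =o[𝓝 0] fun t : ℝ => t ^ 2 := by
      simpa [HasJetTwo] using h₁
    simpa using h₂.mul_isBigO (hbdd j l)
  have hrem : HasJetTwo (fun t => ∑ j, ∑ i, (1 - G t) k i * (1 - G t) i j * (G t)⁻¹ j l) 0 0 0 :=
    .of_isLittleO (IsLittleO.fun_sum fun j _ => IsLittleO.fun_sum fun i _ => hsq i j)
  have hmain := ((HasJetTwo.const ((1 : Matrix ι ι ℝ) k l)).add (hd k l)).add hrem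
  refine (hmain.of_eq (by simp [Matrix.one_apply]) (by simp) (by simp)).congr' ?_
  -- `G⁻¹ = 1 + (1 - G) + (1 - G)² G⁻¹`
  filter_upwards [hGH] with t ht
  have hmat : (G t)⁻¹ = 1 + (1 - G t) + (1 - G t) * (1 - G t) * (G t)⁻¹ := by
    have : (1 - G t) * (1 - G t) * (G t)⁻¹ = (G t)⁻¹ - 1 - (1 - G t) := by
      simp only [sub_mul, mul_sub, one_mul, mul_one, mul_assoc, ht]
    rw [this]; abel
  conv_rhs => rw [hmat]
  simp only [Matrix.add_apply, Matrix.mul_apply, Finset.sum_mul]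

end GramInverse

/-! ### Lower supports in coordinates -/

section Support

open Filter Topology

variable {E : Type*} [NormedAddCommGroup E] [NormedSpace ℝ E]

theorem apply_sum_smul_of_diag {ι : Type*} [DecidableEq ι] {b : E →L[ℝ] E →L[ℝ] ℝ} {e : ι → E}
    {d : ι → ℝ} (hb : ∀ k l, b (e k) (e l) = if k = l then d k else 0) (T : Finset ι)
    (x : ι → ℝ) :
    b (∑ r ∈ T, x r • e r) (∑ r ∈ T, x r • e r) = ∑ r ∈ T, x r ^ 2 * d r := by
  simp only [map_sum, map_smul, sum_apply, smul_apply, hb, smul_eq_mul]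
  refine Finset.sum_congr rfl fun r hr => ?_
  simp [hr]
  ring

theorem apply_sum_smul_of_notMem {ι : Type*} [DecidableEq ι] {b : E →L[ℝ] E →L[ℝ] ℝ} {e : ι → E}
    {d : ι → ℝ} (hb : ∀ k l, b (e k) (e l) = if k = l then d k else 0) {T : Finset ι} {k : ι}
    (hk : k ∉ T) (x : ι → ℝ) : b (e k) (∑ r ∈ T, x r • e r) = 0 := by
  simp only [map_sum, map_smul, hb, smul_eq_mul]
  refine Finset.sum_eq_zero fun r hr => ?_
  rw [if_neg (by rintro rfl; exact hk hr), mul_zero]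

/-- The Taylor expansions to second order, along the line `t ↦ y + t u`, of a function `F` and of
the Gram-weighted trace that bounds it from above are compared. The trace is taken over the frame
`e k + t ∑ c k r • e r` (`k ∈ S`, `r ∈ T`), carried along by second-order parallel transport. -/
theorem support_derivatives_along_line [FiniteDimensional ℝ E]
    {g a : E → E →L[ℝ] E →L[ℝ] ℝ} {F : E → ℝ} {y : E}
    (hg : ContDiffAt ℝ ∞ g y) (ha : ContDiffAt ℝ ∞ a y) (hF : ContDiffAt ℝ ∞ F y)
    (hinv : (g y).IsInvertible) (hgs : ∀ z v w, g z v w = g z w v)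
    (has : ∀ z v w, a z v w = a z w v)
    {ι : Type*} [DecidableEq ι] {e : ι → E} {lam : ι → ℝ}
    (hge : ∀ k l, g y (e k) (e l) = if k = l then 1 else 0)
    (hae : ∀ k l, a y (e k) (e l) = if k = l then lam k else 0) {S T : Finset ι}
    (hST : ∀ k ∈ S, ∀ r ∈ T, lam k < lam r)
    (hle : ∀ᶠ z in 𝓝 y, ∀ (w : S → E) (H : Matrix S S ℝ),
      Matrix.of (fun k l => g z (w k) (w l)) * H = 1 → F z ≤ ∑ k, ∑ l, H k l * a z (w k) (w l))
    (heq : F y = ∑ k ∈ S, lam k) (u : E) :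
    fderiv ℝ F y u = ∑ k ∈ S, coordCov g a y u (e k) (e k) ∧
    fderiv ℝ (fderiv ℝ F) y u u ≤
      ∑ k ∈ S, (coordCov₂ g a y u u (e k) (e k) +
        coordCov g a y (christoffel g y u u) (e k) (e k)) -
      2 * ∑ k ∈ S, ∑ r ∈ T, coordCov g a y u (e k) (e r) ^ 2 / (lam r - lam k) := by
  -- `c k r` minimises its contribution `4 c (∇_u a)(e k, e r) + 2 (lam r - lam k) c²` to the second
  -- derivative of the trace.
  set c : ι → ι → ℝ := fun k r => -coordCov g a y u (e k) (e r) / (lam r - lam k) with hc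
  set η : ι → E := fun k => ∑ r ∈ T, c k r • e r with hη
  have hdisj : ∀ k ∈ S, k ∉ T := fun k hk hkT => lt_irrefl _ (hST k hk k hkT)
  have hg0 : ∀ k ∈ S, ∀ l, g y (e k) (η l) = 0 := fun k hk l =>
    apply_sum_smul_of_notMem hge (hdisj k hk) (c l)
  have ha0 : ∀ k ∈ S, ∀ l, a y (e k) (η l) = 0 := fun k hk l =>
    apply_sum_smul_of_notMem hae (hdisj k hk) (c l)
  have hcs := coordCov_symm g (ha.differentiableAt (by simp)) has u
  have hG : ∀ k l : S, HasJetTwo (fun t => Matrix.of (fun k l : S =>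
      pullback (g (y + t • u)) (transport g y u t) (e k + t • η k) (e l + t • η l)) k l)
      (if k = l then 1 else 0) 0 (2 * g y (η k) (η l)) := fun k l =>
    (HasJetTwo.bilinear_affine (hasJetTwo_transport_metric hg hinv hgs u)
      (e k) (η k) (e l) (η l)).of_eq (by rw [hge]; simp only [Subtype.ext_iff])
      (by rw [hg0 k k.2, hgs, hg0 l l.2]; ring) (by ring)
  have hA : ∀ k l : S, HasJetTwo (fun t =>
      pullback (a (y + t • u)) (transport g y u t) (e k + t • η k) (e l + t • η l))
      (if k = l then lam k else 0) (coordCov g a y u (e k) (e l))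
      (coordCov₂ g a y u u (e k) (e l) + coordCov g a y (christoffel g y u u) (e k) (e l) +
        2 * (coordCov g a y u (e k) (η l) + coordCov g a y u (η k) (e l)) +
        2 * a y (η k) (η l)) := fun k l =>
    (HasJetTwo.bilinear_affine (hasJetTwo_transport hg hinv ha u)
      (e k) (η k) (e l) (η l)).of_eq (by rw [hae]; simp only [Subtype.ext_iff])
      (by rw [ha0 k k.2, has, ha0 l l.2]; ring) rfl
  obtain ⟨H, hGH, hH⟩ := HasJetTwo.exists_matrix_inverse hG
  have htr := HasJetTwo.sum Finset.univ fun k (_ : k ∈ Finset.univ) =>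
    HasJetTwo.sum Finset.univ fun l (_ : l ∈ Finset.univ) => (hH k l).mul (hA k l)
  have hFjet := hasJetTwo_comp_line hF u
  have hcmp : ∀ᶠ t in 𝓝 (0 : ℝ), F (y + t • u) ≤ ∑ k : S, ∑ l : S, H t k l *
      pullback (a (y + t • u)) (transport g y u t) (e k + t • η k) (e l + t • η l) := by
    filter_upwards [(tendsto_line y u).eventually hle, hGH] with t ht htH
    exact ht (fun k => transport g y u t (e k + t • η k)) (H t) htH
  obtain ⟨h₁, h₂⟩ := hFjet.le_of_eventually_le (htr.of_eq (by
    rw [heq, ← Finset.sum_coe_sort S]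
    exact Finset.sum_congr rfl fun k _ => by simp) rfl rfl) hcmp
  refine ⟨?_, ?_⟩
  · rw [h₁, ← Finset.sum_coe_sort S]
    exact Finset.sum_congr rfl fun k _ => by simp
  · refine h₂.trans_eq ?_
    rw [← Finset.sum_coe_sort S, ← Finset.sum_coe_sort S, Finset.mul_sum,
      ← Finset.sum_sub_distrib]
    refine Finset.sum_congr rfl fun k _ => ?_
    have hcov : coordCov g a y u (e k) (η k) = ∑ r ∈ T, c k r * coordCov g a y u (e k) (e r) := by
      simp [hη]
    have haη := apply_sum_smul_of_diag hae T (c k)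
    have hgη := apply_sum_smul_of_diag hge T (c k)
    have hsum : ∑ r ∈ T, coordCov g a y u (e k) (e r) ^ 2 / (lam r - lam k) =
        -(2 * ∑ r ∈ T, c k r * coordCov g a y u (e k) (e r) + ∑ r ∈ T, c k r ^ 2 * lam r -
          (∑ r ∈ T, c k r ^ 2 * 1) * lam k) := by
      rw [Finset.mul_sum, Finset.sum_mul, ← Finset.sum_add_distrib, ← Finset.sum_sub_distrib,
        ← Finset.sum_neg_distrib]
      refine Finset.sum_congr rfl fun r hr => ?_
      have : lam r - lam k ≠ 0 := (sub_pos.2 (hST k k.2 r hr)).ne'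
      simp only [hc]
      field_simp
      ring
    change a y (η k) (η k) = _ at haη
    change g y (η k) (η k) = _ at hgη
    simp only [zero_mul, mul_zero, add_zero, ite_mul, mul_ite, one_mul, Finset.sum_add_distrib,
      Finset.sum_ite_eq, Finset.mem_univ, if_true]
    rw [hcs (η k) (e k), hcov, haη, hgη, hsum]
    ring

/-- The two conclusions in coordinates. The Hessian inequality needs the first derivative in
direction `Γ(u, u)` as well, because straight lines are not geodesics. -/
theorem coord_support_derivatives [FiniteDimensional ℝ E]
    {g a : E → E →L[ℝ] E →L[ℝ] ℝ} {F : E → ℝ} {y : E}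
    (hg : ContDiffAt ℝ ∞ g y) (ha : ContDiffAt ℝ ∞ a y) (hF : ContDiffAt ℝ ∞ F y)
    (hinv : (g y).IsInvertible) (hgs : ∀ z v w, g z v w = g z w v)
    (has : ∀ z v w, a z v w = a z w v)
    {ι : Type*} [DecidableEq ι] {e : ι → E} {lam : ι → ℝ}
    (hge : ∀ k l, g y (e k) (e l) = if k = l then 1 else 0)
    (hae : ∀ k l, a y (e k) (e l) = if k = l then lam k else 0) {S T : Finset ι}
    (hST : ∀ k ∈ S, ∀ r ∈ T, lam k < lam r)
    (hle : ∀ᶠ z in 𝓝 y, ∀ (w : S → E) (H : Matrix S S ℝ),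
      Matrix.of (fun k l => g z (w k) (w l)) * H = 1 → F z ≤ ∑ k, ∑ l, H k l * a z (w k) (w l))
    (heq : F y = ∑ k ∈ S, lam k) (u : E) :
    fderiv ℝ F y u = ∑ k ∈ S, coordCov g a y u (e k) (e k) ∧
    coordHessian g F y u u ≤ ∑ k ∈ S, coordCov₂ g a y u u (e k) (e k) -
      2 * ∑ k ∈ S, ∑ r ∈ T, coordCov g a y u (e k) (e r) ^ 2 / (lam r - lam k) := by
  have h := support_derivatives_along_line hg ha hF hinv hgs has hge hae hST hle heq
  refine ⟨(h u).1, ?_⟩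
  have h₂ := (h u).2
  rw [Finset.sum_add_distrib] at h₂
  rw [coordHessian, (h (christoffel g y u u)).1]
  linarith

end Support

/-! ### From the manifold to coordinates -/

section Manifold

open Filter Topology

variable {n : ℕ} {M : Type*} [TopologicalSpace M] [ChartedSpace (EuclideanSpace ℝ (Fin n)) M]

theorem coordTensor_symm (p : M)
    {β : Π x : M, TangentSpace (𝓡 n) x →L[ℝ] TangentSpace (𝓡 n) x →L[ℝ] ℝ}
    (hβ : ∀ (x : M) (v w : TangentSpace (𝓡 n) x), β x v w = β x w v)
    (y v w : EuclideanSpace ℝ (Fin n)) : coordTensor p β y v w = coordTensor p β y w v :=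
  hβ _ _ _

variable [IsManifold (𝓡 n) ∞ M]

/-- The coordinate vector fields of a chart are smooth. -/
theorem contMDiffAt_coordVectorField (p : M) (v : EuclideanSpace ℝ (Fin n)) :
    ContMDiffAt 𝓘(ℝ, EuclideanSpace ℝ (Fin n)) ((𝓡 n).prod 𝓘(ℝ, EuclideanSpace ℝ (Fin n))) ∞
      (fun y => TotalSpace.mk' (EuclideanSpace ℝ (Fin n)) (E := TangentSpace (𝓡 n) (M := M))
        ((extChartAt (𝓡 n) p).symm y)
        (mfderiv 𝓘(ℝ, EuclideanSpace ℝ (Fin n)) (𝓡 n) (extChartAt (𝓡 n) p).symm y v))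
      (extChartAt (𝓡 n) p p) := by
  set s := (extChartAt (𝓡 n) p).target with hs
  have hopen : IsOpen s := isOpen_extChartAt_target p
  have hmem : s ∈ 𝓝 (extChartAt (𝓡 n) p p) := extChartAt_target_mem_nhds p
  have : IsManifold (𝓡 n) 1 M := IsManifold.of_le (n := ∞) (by simp)
  have h₁ := (contMDiffOn_extChartAt_symm (I := 𝓡 n) (n := ∞) p).contMDiffOn_tangentMapWithin
    (m := ∞) (by simp) hopen.uniqueMDiffOn
  have h₂ : ContMDiff 𝓘(ℝ, EuclideanSpace ℝ (Fin n)) 𝓘(ℝ, EuclideanSpace ℝ (Fin n)).tangent ∞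
      (fun y => TotalSpace.mk' (EuclideanSpace ℝ (Fin n))
        (E := TangentSpace 𝓘(ℝ, EuclideanSpace ℝ (Fin n))) y v) :=
    contMDiff_vectorSpace_iff_contDiff.2 contDiff_const
  have h₃ := (h₁.comp h₂.contMDiffOn (s := s) fun y hy => hy).contMDiffAt hmem
  refine h₃.congr_of_eventuallyEq ?_
  filter_upwards [hmem] with y hy
  simp only [Function.comp, tangentMapWithin]
  rw [mfderivWithin_of_isOpen hopen hy]

theorem contDiffAt_coordTensor (p : M)
    {β : Π x : M, TangentSpace (𝓡 n) x →L[ℝ] TangentSpace (𝓡 n) x →L[ℝ] ℝ}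
    (hβ : ContMDiff (𝓡 n)
      ((𝓡 n).prod 𝓘(ℝ, EuclideanSpace ℝ (Fin n) →L[ℝ] EuclideanSpace ℝ (Fin n) →L[ℝ] ℝ)) ∞
      (fun x => TotalSpace.mk'
        (EuclideanSpace ℝ (Fin n) →L[ℝ] EuclideanSpace ℝ (Fin n) →L[ℝ] ℝ) x (β x))) :
    ContDiffAt ℝ ∞ (coordTensor p β) (extChartAt (𝓡 n) p p) := by
  have : IsManifold (𝓡 n) 1 M := IsManifold.of_le (n := ∞) (by simp)
  refine contDiffAt_clm_of_apply fun v => contDiffAt_clm_of_apply fun w => ?_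
  rw [← contMDiffAt_iff_contDiffAt]
  have hbase : ContMDiffAt 𝓘(ℝ, EuclideanSpace ℝ (Fin n)) (𝓡 n) ∞ (extChartAt (𝓡 n) p).symm
      (extChartAt (𝓡 n) p p) :=
    (contMDiffOn_extChartAt_symm p).contMDiffAt (extChartAt_target_mem_nhds p)
  have h := ContMDiffAt.clm_bundle_apply₂ (F₁ := EuclideanSpace ℝ (Fin n))
    (F₂ := EuclideanSpace ℝ (Fin n)) (F₃ := ℝ) (E₃ := Bundle.Trivial M ℝ)
    (hβ.contMDiffAt.comp _ hbase)
    (contMDiffAt_coordVectorField p v) (contMDiffAt_coordVectorField p w)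
  rw [contMDiffAt_totalSpace] at h
  exact h.2

/-- The tangent space at `p` is modelled on the coordinate space by the preferred chart at `p`, so
the differential of that chart is the identity. -/
theorem coordVec_eq_id (p : M) :
    coordVec (n := n) p = ContinuousLinearMap.id ℝ (EuclideanSpace ℝ (Fin n)) := by
  have : IsManifold (𝓡 n) 1 M := IsManifold.of_le (n := ∞) (by simp)
  exact mfderiv_extChartAt_self

theorem coordTensor_coordVec (p : M)
    (β : Π x : M, TangentSpace (𝓡 n) x →L[ℝ] TangentSpace (𝓡 n) x →L[ℝ] ℝ)
    (v w : TangentSpace (𝓡 n) p) :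
    coordTensor p β (extChartAt (𝓡 n) p p) (coordVec p v) (coordVec p w) = β p v w := by
  have : IsManifold (𝓡 n) 1 M := IsManifold.of_le (n := ∞) (by simp)
  have hL : mfderiv 𝓘(ℝ, EuclideanSpace ℝ (Fin n)) (𝓡 n) (extChartAt (𝓡 n) p).symm
      (extChartAt (𝓡 n) p p) = ContinuousLinearMap.id ℝ _ := by
    rw [← mfderivWithin_univ, ← (𝓡 n).range_eq_univ]
    exact mfderivWithin_range_extChartAt_symm
  have hpt : ∀ q, q = p → ∀ v w : EuclideanSpace ℝ (Fin n), β q v w = β p v w := by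
    rintro q rfl v w
    rfl
  rw [coordVec_eq_id (n := n) p]
  change β _ (mfderiv 𝓘(ℝ, EuclideanSpace ℝ (Fin n)) (𝓡 n) (extChartAt (𝓡 n) p).symm
      (extChartAt (𝓡 n) p p) v) (mfderiv 𝓘(ℝ, EuclideanSpace ℝ (Fin n)) (𝓡 n)
      (extChartAt (𝓡 n) p).symm (extChartAt (𝓡 n) p p) w) = _
  rw [hL]
  exact hpt _ (extChartAt_to_inv p) v w

theorem mfderiv_apply_eq_fderiv_coord {ξ : M → ℝ} {p : M}
    (hξ : MDifferentiableAt (𝓡 n) 𝓘(ℝ, ℝ) ξ p) (v : TangentSpace (𝓡 n) p) :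
    mfderiv (𝓡 n) 𝓘(ℝ, ℝ) ξ p v =
      fderiv ℝ (ξ ∘ (extChartAt (𝓡 n) p).symm) (extChartAt (𝓡 n) p p) (coordVec p v) := by
  rw [hξ.mfderiv, coordVec_eq_id (n := n) p, (𝓡 n).range_eq_univ, fderivWithin_univ]
  rfl

theorem contDiffAt_comp_extChartAt_symm {ξ : M → ℝ} {p : M}
    (hξ : ContMDiffAt (𝓡 n) 𝓘(ℝ, ℝ) ∞ ξ p) :
    ContDiffAt ℝ ∞ (ξ ∘ (extChartAt (𝓡 n) p).symm) (extChartAt (𝓡 n) p p) := by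
  rw [← contMDiffAt_iff_contDiffAt]
  refine ContMDiffAt.comp_of_eq (I' := 𝓡 n) hξ ?_ (extChartAt_to_inv p)
  exact (contMDiffOn_extChartAt_symm p).contMDiffAt (extChartAt_target_mem_nhds p)

section Metric

variable [RiemannianBundle (fun x : M => TangentSpace (𝓡 n) x)]

theorem contMDiff_metric
    [h : IsContMDiffRiemannianBundle (𝓡 n) ∞ (EuclideanSpace ℝ (Fin n))
      (fun x : M => TangentSpace (𝓡 n) x)] :
    ContMDiff (𝓡 n)
      ((𝓡 n).prod 𝓘(ℝ, EuclideanSpace ℝ (Fin n) →L[ℝ] EuclideanSpace ℝ (Fin n) →L[ℝ] ℝ)) ∞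
      (fun x : M => TotalSpace.mk'
        (EuclideanSpace ℝ (Fin n) →L[ℝ] EuclideanSpace ℝ (Fin n) →L[ℝ] ℝ) x (metric (n := n) x)) := by
  obtain ⟨g, hg, hgi⟩ := h.exists_contMDiff
  have : g = metric (n := n) := by
    ext x v w
    exact (hgi x v w).symm
  rwa [this] at hg

theorem isInvertible_coordTensor_metric (p : M) :
    (coordTensor p (metric (n := n)) (extChartAt (𝓡 n) p p)).IsInvertible := by
  set G := coordTensor p (metric (n := n)) (extChartAt (𝓡 n) p p) with hG
  have hinj : Function.Injective G.toLinearMap := by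
    refine (injective_iff_map_eq_zero _).2 fun v hv => ?_
    have h := coordTensor_coordVec p (metric (n := n)) (v : TangentSpace (𝓡 n) p) v
    rw [coordVec_eq_id (n := n) p] at h
    have h0 : G v v = 0 := by
      change G.toLinearMap v v = 0
      rw [hv]; rfl
    exact inner_self_eq_zero (𝕜 := ℝ) (E := TangentSpace (𝓡 n) p).1 (h.symm.trans h0)
  have hrank : Module.finrank ℝ (EuclideanSpace ℝ (Fin n)) =
      Module.finrank ℝ (EuclideanSpace ℝ (Fin n) →L[ℝ] ℝ) :=
    (InnerProductSpace.toDual ℝ (EuclideanSpace ℝ (Fin n))).toLinearEquiv.finrank_eq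
  exact ⟨(LinearEquiv.ofInjectiveOfFinrankEq G.toLinearMap hinj hrank).toContinuousLinearEquiv,
    by ext; rfl⟩

end Metric

end Manifold

/-! ### The trace on a span of basis vectors -/

theorem traceOn_span_orthonormal {V : Type*} [NormedAddCommGroup V] [InnerProductSpace ℝ V]
    [FiniteDimensional ℝ V] {ι : Type*} {e : ι → V} (he : Orthonormal ℝ e) (S : Finset ι)
    (B : V →L[ℝ] V →L[ℝ] ℝ) :
    traceOn (Submodule.span ℝ (e '' S)) B = ∑ k ∈ S, B (e k) (e k) := by
  classical
  have himg : e '' (S : Set ι) = ((S.image e : Finset V) : Set V) := by simp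
  rw [himg, traceOn, LinearMap.trace_eq_sum_inner _ (OrthonormalBasis.span he S),
    ← Finset.sum_coe_sort S]
  refine Finset.sum_congr rfl fun k _ => ?_
  rw [real_inner_comm, inner_sharp]
  change B (OrthonormalBasis.span he S k : V) (OrthonormalBasis.span he S k : V) = _
  rw [OrthonormalBasis.span_apply]

end Subtrace

theorem mainTheorem3 {n : ℕ} {M : Type*} [TopologicalSpace M]
    [ChartedSpace (EuclideanSpace ℝ (Fin n)) M] [IsManifold (𝓡 n) ∞ M]
    [RiemannianBundle (fun x : M => TangentSpace (𝓡 n) x)]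
    [IsContMDiffRiemannianBundle (𝓡 n) ∞ (EuclideanSpace ℝ (Fin n))
      (fun x : M => TangentSpace (𝓡 n) x)]
    (α : Π x : M, TangentSpace (𝓡 n) x →L[ℝ] TangentSpace (𝓡 n) x →L[ℝ] ℝ)
    (hα : ContMDiff (𝓡 n)
      ((𝓡 n).prod 𝓘(ℝ, EuclideanSpace ℝ (Fin n) →L[ℝ] EuclideanSpace ℝ (Fin n) →L[ℝ] ℝ)) ∞
      (fun x => TotalSpace.mk'
        (EuclideanSpace ℝ (Fin n) →L[ℝ] EuclideanSpace ℝ (Fin n) →L[ℝ] ℝ) x (α x)))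
    (hsymm : ∀ (x : M) (v w : TangentSpace (𝓡 n) x), α x v w = α x w v)
    (m : ℕ) (hm : 1 ≤ m) (hmn : m ≤ n) (x₀ : M) (ξ : M → ℝ)
    (hξ : Subtrace.IsLowerSupportAt n ξ (fun x => Subtrace.subtrace m (α x) (hsymm x)) x₀)
    -- an orthonormal basis of eigenvectors at `x₀`, with eigenvalues in increasing order
    (e : OrthonormalBasis (Fin n) ℝ (TangentSpace (𝓡 n) x₀)) (lam : Fin n → ℝ)
    (hlam : Monotone lam) (he : ∀ k, Subtrace.sharp (α x₀) (e k) = lam k • e k)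
    -- `lam_m = ⋯ = lam_D < lam_{D+1}` (indices are shifted by one)
    (D : ℕ) (hmD : m ≤ D) (hDn : D ≤ n)
    (hD : ∀ k r : Fin n, k.val + 1 = m →
      (k ≤ r → r.val < D → lam r = lam k) ∧ (D ≤ r.val → lam k < lam r))
    (i : Fin n) :
    mfderiv (𝓡 n) 𝓘(ℝ, ℝ) ξ x₀ (e i) =
        Subtrace.traceOn (Submodule.span ℝ (e '' {k : Fin n | k.val < m}))
          (Subtrace.cov α x₀ (e i)) ∧
    mfderiv (𝓡 n) 𝓘(ℝ, ℝ) ξ x₀ (e i) =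
        ∑ k : Fin n with k.val < m, Subtrace.cov α x₀ (e i) (e k) (e k) ∧
    Subtrace.hessian ξ x₀ (e i) (e i) ≤
        ∑ k : Fin n with k.val < m, Subtrace.cov₂ α x₀ (e i) (e i) (e k) (e k) -
          2 * ∑ k : Fin n with k.val < m, ∑ r : Fin n with D ≤ r.val,
            (Subtrace.cov α x₀ (e i) (e k) (e r)) ^ 2 / (lam r - lam k) := by
  obtain ⟨U, hUo, hxU, hξU, hξle, hξeq⟩ := hξ
  have hξat : ContMDiffAt (𝓡 n) 𝓘(ℝ, ℝ) ∞ ξ x₀ := hξU.contMDiffAt (hUo.mem_nhds hxU)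
  set φ := extChartAt (𝓡 n) x₀ with hφ
  set S : Finset (Fin n) := Finset.univ.filter fun k => k.val < m with hS
  set T : Finset (Fin n) := Finset.univ.filter fun r => D ≤ r.val with hT
  have hmetric : ∀ (x : M) (v w : TangentSpace (𝓡 n) x),
      Subtrace.metric (n := n) x v w = inner ℝ v w := fun x v w => rfl
  have hge : ∀ k l, Subtrace.coordTensor x₀ (Subtrace.metric (n := n)) (φ x₀)
      (Subtrace.coordVec x₀ (e k)) (Subtrace.coordVec x₀ (e l)) = if k = l then 1 else 0 := by
    intro k l
    rw [Subtrace.coordTensor_coordVec, hmetric]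
    exact orthonormal_iff_ite.1 e.orthonormal k l
  have hae : ∀ k l, Subtrace.coordTensor x₀ α (φ x₀)
      (Subtrace.coordVec x₀ (e k)) (Subtrace.coordVec x₀ (e l)) = if k = l then lam k else 0 := by
    intro k l
    rw [Subtrace.coordTensor_coordVec, ← Subtrace.inner_sharp, he, real_inner_smul_left,
      orthonormal_iff_ite.1 e.orthonormal k l, mul_ite, mul_one, mul_zero]
  have hST : ∀ k ∈ S, ∀ r ∈ T, lam k < lam r := by
    intro k hk r hr
    simp only [hS, hT, Finset.mem_filter, Finset.mem_univ, true_and] at hk hr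
    -- The hypothesis on the gap concerns the `m`-th eigenvalue, whose index is `m - 1`.
    have hlast := (hD ⟨m - 1, by omega⟩ r (by simp only; omega)).2 hr
    exact (hlam (by rw [Fin.le_def]; simp only; omega)).trans_lt hlast
  have hcont : ContinuousAt φ.symm (φ x₀) := continuousAt_extChartAt_symm x₀
  have hinv : φ.symm (φ x₀) = x₀ := extChartAt_to_inv x₀
  -- Ky Fan's principle at the points near `x₀`, written in the chart.
  have hle : ∀ᶠ z in nhds (φ x₀), ∀ (w : S → EuclideanSpace ℝ (Fin n)) (H : Matrix S S ℝ),
      Matrix.of (fun k l => Subtrace.coordTensor x₀ (Subtrace.metric (n := n)) z (w k) (w l)) * H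
        = 1 → (ξ ∘ φ.symm) z ≤ ∑ k, ∑ l, H k l * Subtrace.coordTensor x₀ α z (w k) (w l) := by
    filter_upwards [hcont.preimage_mem_nhds (by rw [hinv]; exact hUo.mem_nhds hxU)]
      with z hz w H hH
    have hrank : Module.finrank ℝ (TangentSpace (𝓡 n) (φ.symm z)) = n :=
      finrank_euclideanSpace_fin
    exact (hξle _ hz).trans (Subtrace.subtrace_le_trace_gram_inverse_mul hm
      (hmn.trans_eq hrank.symm) (α (φ.symm z)) (hsymm _)
      (by rw [Fintype.card_coe, Subtrace.card_filter_val_lt hmn])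
      (fun k => mfderiv 𝓘(ℝ, EuclideanSpace ℝ (Fin n)) (𝓡 n) φ.symm z (w k)) H hH)
  have heq : (ξ ∘ φ.symm) (φ x₀) = ∑ k ∈ S, lam k := by
    rw [Function.comp_apply, hinv, hξeq]
    exact Subtrace.subtrace_eq_sum_of_monotone_eigenbasis hm hmn _ _ e lam hlam he
  obtain ⟨h₁, h₂⟩ := Subtrace.coord_support_derivatives
    (Subtrace.contDiffAt_coordTensor x₀ Subtrace.contMDiff_metric)
    (Subtrace.contDiffAt_coordTensor x₀ hα)
    (Subtrace.contDiffAt_comp_extChartAt_symm hξat)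
    (Subtrace.isInvertible_coordTensor_metric x₀)
    (Subtrace.coordTensor_symm x₀ fun x v w => real_inner_comm w v)
    (Subtrace.coordTensor_symm x₀ hsymm) hge hae hST hle heq (Subtrace.coordVec x₀ (e i))
  have hfirst : mfderiv (𝓡 n) 𝓘(ℝ, ℝ) ξ x₀ (e i) =
      ∑ k ∈ S, Subtrace.cov α x₀ (e i) (e k) (e k) := by
    rw [Subtrace.mfderiv_apply_eq_fderiv_coord (hξat.mdifferentiableAt (by simp))]
    exact h₁
  refine ⟨?_, hfirst, h₂⟩
  have hset : {k : Fin n | k.val < m} = (S : Set (Fin n)) := by simp [hS]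
  rw [hfirst, hset]
  exact (Subtrace.traceOn_span_orthonormal e.orthonormal S _).symm
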